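/- Let $A$ be an integer $k\times s$ matrix such that (1) $A$ is unimodular, i.e., for every $b$ in the lattice $\mathbb{Z}A\subseteq\mathbb{Z}^k$ spanned by the columns of $A$, all vertices of the polyhedron $\{x\in\mathbb{R}^s : Ax=b,\ x\geq 0\}$ are integral; (2) $\operatorname{Ker}(A)\cap\mathbb{R}_{\geq 0}^s=\{0\}$. Let $m(n)=(m_1(n),\dots,m_k(n))^T$, where $m_1,\dots,m_k\in\mathbb{Q}[n]$ are integer-valued polynomials (they take integer values at all $n\in\mathbb{N}$), and suppose that $m(n)\in\mathbb{Z}A$ for all $n\in\mathbb{N}$ (this holds automatically if $\mathbb{Z}A=\mathbb{Z}^k$). Then for every $n\in\mathbb{N}$ the number $$t(m(n)\mid A)=\#\{x\in\mathbb{Z}_{\geq 0}^s : Ax=m(n)\}$$ is finite, and there is a polynomial $P\in\mathbb{Q}[n]$ such that $t(m(n)\mid A)=P(n)$ for all sufficiently large $n$. -/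

import Mathlib

open Polynomial

namespace VectorPartition

/-- A rational polynomial taking integer values at all natural numbers. -/
def IsIntegerValued (p : ℚ[X]) : Prop :=
  ∀ n : ℕ, ∃ c : ℤ, p.eval (n : ℚ) = (c : ℚ)

/-- The lattice `ℤA` spanned by the columns of `A`. -/
def columnLattice {k s : ℕ} (A : Matrix (Fin k) (Fin s) ℤ) : Submodule ℤ (Fin k → ℤ) :=
  Submodule.span ℤ (Set.range A.col)

/-- The matrix `A` with its entries regarded as real numbers. -/
def realMatrix {k s : ℕ} (A : Matrix (Fin k) (Fin s) ℤ) : Matrix (Fin k) (Fin s) ℝ :=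
  A.map (fun a : ℤ => (a : ℝ))

/-- The polyhedron `{x ∈ ℝ^s : A x = b, x ≥ 0}`. -/
def polyhedron {k s : ℕ} (A : Matrix (Fin k) (Fin s) ℤ) (b : Fin k → ℤ) :
    Set (Fin s → ℝ) :=
  {x | (realMatrix A).mulVec x = (fun i => (b i : ℝ)) ∧ 0 ≤ x}

/-- `A` is unimodular: for every `b` in the lattice spanned by the columns of `A`, all vertices
(extreme points) of `{x : A x = b, x ≥ 0}` are integral. -/
def IsUnimodular {k s : ℕ} (A : Matrix (Fin k) (Fin s) ℤ) : Prop :=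
  ∀ b ∈ columnLattice A, ∀ v ∈ (polyhedron A b).extremePoints ℝ,
    ∃ z : Fin s → ℤ, v = fun j => (z j : ℝ)

/-- The set of nonnegative integer solutions `x` of `A x = m(n)`. -/
def solutions {k s : ℕ} (A : Matrix (Fin k) (Fin s) ℤ) (m : Fin k → ℚ[X]) (n : ℕ) :
    Set (Fin s → ℕ) :=
  {x | ∀ i, ((∑ j, A i j * (x j : ℤ) : ℤ) : ℚ) = (m i).eval (n : ℚ)}

end VectorPartition

/-! Write `F_w(b)` for the coefficient of `z ^ b` in `∏ j, (1 - z ^ a_j) ^ (-w j)`, with `a_j` the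
columns; the required count is `F_w` with all weights one. Multiplying by `1 - z ^ a_j` lowers one
weight, so `F_{w+e_j}(b) - F_{w+e_j}(b - a_j) = F_w(b)` (`weightedCount_add_single`).

If the columns with nonzero weight are independent, at most one `x` contributes, and its coordinates
are linear in `b`. Unimodularity makes these integral, so no congruence conditions arise, and along
a polynomial path their signs are eventually constant.

If those columns are dependent, unimodularity makes some `a_e` an integer combination of the others.
Then `F_w` is the `a_e`-difference of `F_{w+e_e}`, which telescopes into shifted differences along
the other `a_j`, that is, into shifts of `± F_{w+e_e-e_j}`. Weight thus moves onto `e` until some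
other column drops out of the support. -/

namespace VectorPartition

open Filter Function

variable {k s : ℕ}

/-- The nonnegative integer solutions of `A x = b`. -/
def fiber (A : Matrix (Fin k) (Fin s) ℤ) (b : Fin k → ℤ) : Set (Fin s → ℕ) :=
  {x | A.mulVec (fun j => (x j : ℤ)) = b}

/-- The coefficient of `z ^ b` in `∏ j, (1 - z ^ (A.col j)) ^ (- w j)`, as a weighted count of the
nonnegative integer solutions of `A x = b`. -/
noncomputable def weightedCount (A : Matrix (Fin k) (Fin s) ℤ) (w : Fin s → ℕ)
    (b : Fin k → ℤ) : ℚ :=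
  ∑ᶠ x ∈ fiber A b, ∏ j, ((w j).multichoose (x j) : ℚ)

/-- The function `f` on the lattice `ℤA` is eventually polynomial along each polynomial path. -/
def EventuallyPolynomialOnPaths (A : Matrix (Fin k) (Fin s) ℤ) (f : (Fin k → ℤ) → ℚ) : Prop :=
  ∀ (m : Fin k → ℚ[X]) (b : ℕ → Fin k → ℤ), (∀ n i, (b n i : ℚ) = (m i).eval (n : ℚ)) →
    (∀ n, b n ∈ columnLattice A) →
      ∃ P : ℚ[X], ∀ᶠ n : ℕ in atTop, f (b n) = P.eval (n : ℚ)

/-! ### Fibers -/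

/-- Two comparable solutions differ by a nonnegative kernel vector, hence coincide; antichains in
`ℕ^s` are finite by Dickson's lemma. -/
theorem fiber_finite {A : Matrix (Fin k) (Fin s) ℤ}
    (hker : (LinearMap.ker (realMatrix A).mulVecLin : Set (Fin s → ℝ)) ∩ {x | 0 ≤ x} = {0})
    (b : Fin k → ℤ) : (fiber A b).Finite := by
  refine WellQuasiOrderedLE.finite_of_isAntichain ?_
  intro x hx y hy hne hle
  apply hne
  have h : (fun j => (y j : ℝ) - x j) ∈
      (LinearMap.ker (realMatrix A).mulVecLin : Set (Fin s → ℝ)) ∩ {x | 0 ≤ x} := by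
    refine ⟨?_, fun j => sub_nonneg.2 (Nat.cast_le.2 (hle j))⟩
    simp only [SetLike.mem_coe, LinearMap.mem_ker, Matrix.mulVecLin_apply]
    ext i
    have h1 := congrFun (hx.trans hy.symm) i
    simp only [Matrix.mulVec, dotProduct] at h1
    have h2 : (∑ j, (A i j : ℝ) * x j) = ∑ j, (A i j : ℝ) * y j := by exact_mod_cast h1
    simp [realMatrix, Matrix.mulVec, dotProduct, mul_sub, Finset.sum_sub_distrib, h2]
  rw [hker] at h
  ext j
  have := congrFun h j
  simp only [Pi.zero_apply, sub_eq_zero] at this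
  exact_mod_cast this.symm

theorem fiber_add_single {A : Matrix (Fin k) (Fin s) ℤ} (b : Fin k → ℤ) (j : Fin s)
    (x : Fin s → ℕ) : x + Pi.single j 1 ∈ fiber A b ↔ x ∈ fiber A (b - A.col j) := by
  have : (fun i => ((x + Pi.single j 1 : Fin s → ℕ) i : ℤ)) =
      (fun i => (x i : ℤ)) + Pi.single j 1 := by
    ext i
    by_cases h : i = j
    · subst h; simp
    · simp [h]
  simp only [fiber, Set.mem_ofPred_eq, this, Matrix.mulVec_add, Matrix.mulVec_single_one]
  exact eq_sub_iff_add_eq.symm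

/-! ### The difference equation -/

/-- Pascal's rule for `multichoose` in the `j`-th factor. The case split is needed because truncated
subtraction is wrong at `x j = 0`. -/
theorem prod_multichoose_add_single (w x : Fin s → ℕ) (j : Fin s) :
    ∏ i, (((w + Pi.single j 1 : Fin s → ℕ) i).multichoose (x i) : ℚ) =
      ∏ i, ((w i).multichoose (x i) : ℚ) +
        if x j = 0 then 0 else
          ∏ i, (((w + Pi.single j 1 : Fin s → ℕ) i).multichoose
            ((x - Pi.single j 1 : Fin s → ℕ) i) : ℚ) := by
  have hoff : ∀ i ∈ (Finset.univ.erase j : Finset (Fin s)),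
      (Pi.single j 1 : Fin s → ℕ) i = 0 := fun i hi => by
    simp [Finset.ne_of_mem_erase hi]
  rw [← Finset.mul_prod_erase _ _ (Finset.mem_univ j),
    ← Finset.mul_prod_erase (f := fun i => ((w i).multichoose (x i) : ℚ)) _ (Finset.mem_univ j),
    ← Finset.mul_prod_erase _ (fun i => (Nat.multichoose _ _ : ℚ)) (Finset.mem_univ j)]
  have h1 : ∏ i ∈ Finset.univ.erase j,
        (((w + Pi.single j 1 : Fin s → ℕ) i).multichoose (x i) : ℚ) =
      ∏ i ∈ Finset.univ.erase j, ((w i).multichoose (x i) : ℚ) :=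
    Finset.prod_congr rfl fun i hi => by simp [hoff i hi]
  have h2 : ∏ i ∈ Finset.univ.erase j,
        (((w + Pi.single j 1 : Fin s → ℕ) i).multichoose ((x - Pi.single j 1 : Fin s → ℕ) i) : ℚ) =
      ∏ i ∈ Finset.univ.erase j, ((w i).multichoose (x i) : ℚ) :=
    Finset.prod_congr rfl fun i hi => by simp [hoff i hi]
  rw [h1, h2]
  simp only [Pi.add_apply, Pi.sub_apply, Pi.single_eq_same]
  rcases x j with _ | t
  · simp
  · simp [Nat.multichoose_succ_succ, add_mul]

theorem weightedCount_add_single {A : Matrix (Fin k) (Fin s) ℤ}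
    (hfin : ∀ b, (fiber A b).Finite) (w : Fin s → ℕ) (j : Fin s) (b : Fin k → ℤ) :
    weightedCount A (w + Pi.single j 1) b =
      weightedCount A w b + weightedCount A (w + Pi.single j 1) (b - A.col j) := by
  simp only [weightedCount]
  rw [finsum_mem_congr rfl (fun x _ => prod_multichoose_add_single w x j),
    finsum_mem_add_distrib (hfin b)]
  congr 1
  have himage := finsum_mem_image
    (f := fun x : Fin s → ℕ => if x j = 0 then (0 : ℚ) else
      ∏ i, (((w + Pi.single j 1 : Fin s → ℕ) i).multichoose ((x - Pi.single j 1 : Fin s → ℕ) i) : ℚ))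
    (s := fiber A (b - A.col j)) (g := fun x => x + Pi.single j 1)
    (add_left_injective _).injOn
  simp only [Pi.add_apply, Pi.single_eq_same, Nat.succ_ne_zero, if_false,
    add_tsub_cancel_right] at himage
  refine Eq.trans ?_ himage
  -- Terms with `x j = 0` vanish; the other solutions are exactly the translates by `e_j` of
  -- solutions for `b - a_j`.
  refine finsum_mem_inter_support_eq _ _ _ ?_
  ext x
  simp only [Set.mem_inter_iff, Set.mem_image, mem_support]
  refine and_congr_left fun hx => ?_
  have hxj : x j ≠ 0 := fun h => hx (by simp [h])
  have hsub : x - Pi.single j 1 + Pi.single j 1 = x := by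
    refine tsub_add_cancel_of_le fun i => ?_
    by_cases h : i = j
    · subst h; simpa using Nat.one_le_iff_ne_zero.2 hxj
    · simp [h]
  constructor
  · intro h
    exact ⟨x - Pi.single j 1, (fiber_add_single b j _).1 (by rwa [hsub]), hsub⟩
  · rintro ⟨y, hy, rfl⟩
    exact (fiber_add_single b j y).2 hy

/-! ### Functions that are eventually polynomial on paths -/

theorem EventuallyPolynomialOnPaths.add {A : Matrix (Fin k) (Fin s) ℤ}
    {f g : (Fin k → ℤ) → ℚ} (hf : EventuallyPolynomialOnPaths A f)
    (hg : EventuallyPolynomialOnPaths A g) : EventuallyPolynomialOnPaths A (fun b => f b + g b) := by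
  intro m b hb hl
  obtain ⟨P, hP⟩ := hf m b hb hl
  obtain ⟨Q, hQ⟩ := hg m b hb hl
  refine ⟨P + Q, ?_⟩
  filter_upwards [hP, hQ] with n h1 h2
  simp [h1, h2]

theorem EventuallyPolynomialOnPaths.neg {A : Matrix (Fin k) (Fin s) ℤ}
    {f : (Fin k → ℤ) → ℚ} (hf : EventuallyPolynomialOnPaths A f) :
    EventuallyPolynomialOnPaths A (fun b => - f b) := by
  intro m b hb hl
  obtain ⟨P, hP⟩ := hf m b hb hl
  refine ⟨-P, ?_⟩
  filter_upwards [hP] with n h1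
  simp [h1]

theorem EventuallyPolynomialOnPaths.shift {A : Matrix (Fin k) (Fin s) ℤ}
    {f : (Fin k → ℤ) → ℚ} (hf : EventuallyPolynomialOnPaths A f) {v : Fin k → ℤ}
    (hv : v ∈ columnLattice A) : EventuallyPolynomialOnPaths A (fun b => f (b - v)) := by
  intro m b hb hl
  exact hf (fun i => m i - C (v i : ℚ)) (fun n => b n - v) (fun n i => by simp [hb])
    (fun n => sub_mem (hl n) hv)

/-- If `F` has eventually polynomial differences in the directions `S ⊆ ℤA`, then also in all
directions of the lattice spanned by `S`. -/
theorem EventuallyPolynomialOnPaths.difference_of_mem_span {A : Matrix (Fin k) (Fin s) ℤ}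
    {F : (Fin k → ℤ) → ℚ} {S : Set (Fin k → ℤ)} (hS : S ⊆ columnLattice A)
    (h : ∀ v ∈ S, EventuallyPolynomialOnPaths A (fun b => F b - F (b - v)))
    {v : Fin k → ℤ} (hv : v ∈ Submodule.span ℤ S) :
    EventuallyPolynomialOnPaths A (fun b => F b - F (b - v)) := by
  have hle : AddSubgroup.closure S ≤ (columnLattice A).toAddSubgroup :=
    (AddSubgroup.closure_le _).2 hS
  have hv' : v ∈ AddSubgroup.closure S := by
    rw [← Submodule.span_int_eq_addSubgroupClosure]
    exact hv
  induction hv' using AddSubgroup.closure_induction with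
  | mem x hx => exact h x hx
  | zero =>
    intro m b _ _
    exact ⟨0, by simp⟩
  | add x y hx hy ihx ihy =>
    have hxs : x ∈ Submodule.span ℤ S := by
      rw [← Submodule.mem_toAddSubgroup, Submodule.span_int_eq_addSubgroupClosure]; exact hx
    have hys : y ∈ Submodule.span ℤ S := by
      rw [← Submodule.mem_toAddSubgroup, Submodule.span_int_eq_addSubgroupClosure]; exact hy
    -- Telescoping through `b - x`.
    convert (ihx hxs).add ((ihy hys).shift (hle hx)) using 2 with b
    rw [sub_add_eq_sub_sub]
    ring
  | neg x hx ih =>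
    have hxs : x ∈ Submodule.span ℤ S := by
      rw [← Submodule.mem_toAddSubgroup, Submodule.span_int_eq_addSubgroupClosure]; exact hx
    convert ((ih hxs).shift (neg_mem (hle hx))).neg using 2 with b
    simp

/-! ### Independent sets of columns -/

/-- The columns of `A` as rational vectors. -/
def rationalColumn (A : Matrix (Fin k) (Fin s) ℤ) (j : Fin s) : Fin k → ℚ := fun i => (A i j : ℚ)

/-- A left inverse of the injective map `c ↦ ∑ j ∈ S, c j • a_j` reads off the coordinates. Its
entries are rational, so coordinates along a path in `ℚ[X]` stay in `ℚ[X]`. -/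
theorem exists_dual_of_linearIndepOn {A : Matrix (Fin k) (Fin s) ℤ} {S : Set (Fin s)}
    (hS : LinearIndepOn ℚ (rationalColumn A) S) :
    ∃ L : Fin s → Fin k → ℚ, ∀ c : Fin s → ℚ, (∀ j ∉ S, c j = 0) →
      ∀ j ∈ S, ∑ i, L j i * ∑ j', (A i j' : ℚ) * c j' = c j := by
  classical
  obtain ⟨g, hg⟩ := LinearMap.exists_leftInverse_of_injective
    (Fintype.linearCombination ℚ (fun j : S => rationalColumn A j))
    (LinearMap.ker_eq_bot.2 (LinearIndependent.fintypeLinearCombination_injective hS))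
  refine ⟨fun j i => if h : j ∈ S then g (fun l => if i = l then 1 else 0) ⟨j, h⟩ else 0, fun c hc j hj => ?_⟩
  have hsum : Fintype.linearCombination ℚ (fun j : S => rationalColumn A j) (fun j => c j) =
      fun i => ∑ j', (A i j' : ℚ) * c j' := by
    ext i
    rw [Fintype.linearCombination_apply, Finset.sum_apply]
    rw [← Finset.sum_subset (Finset.subset_univ S.toFinset)
      (fun l _ hl => by rw [hc l (by simpa using hl), mul_zero])]
    rw [← Finset.sum_set_coe]
    exact Finset.sum_congr rfl fun l _ => mul_comm _ _
  have h1 := congrFun (LinearMap.congr_fun hg (fun j : S => c j)) ⟨j, hj⟩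
  rw [LinearMap.comp_apply, hsum, LinearMap.pi_apply_eq_sum_univ] at h1
  simpa [hj, mul_comm] using h1

/-- A dual family to independent columns recovers real coefficients as well. -/
theorem sum_dual_mul_real {A : Matrix (Fin k) (Fin s) ℤ} {S : Set (Fin s)}
    {L : Fin s → Fin k → ℚ}
    (hL : ∀ c : Fin s → ℚ, (∀ j ∉ S, c j = 0) →
      ∀ j ∈ S, ∑ i, L j i * ∑ j', (A i j' : ℚ) * c j' = c j)
    (c : Fin s → ℝ) (hc : ∀ j ∉ S, c j = 0) {j : Fin s} (hj : j ∈ S) :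
    ∑ i, (L j i : ℝ) * ∑ j', (A i j' : ℝ) * c j' = c j := by
  have hdelta : ∀ j' ∈ S, ∑ i, (L j i : ℝ) * (A i j' : ℝ) = if j = j' then 1 else 0 := by
    intro j' hj'
    have := hL (Pi.single j' 1) (fun l hl => by
      rw [Pi.single_eq_of_ne]; rintro rfl; exact hl hj') j hj
    simp only [Pi.single_apply, mul_ite, mul_one, mul_zero, Finset.sum_ite_eq',
      Finset.mem_univ, if_true] at this
    have hcast := congrArg (Rat.cast : ℚ → ℝ) this
    push_cast at hcast
    rw [hcast]
    split_ifs <;> simp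
  simp_rw [Finset.mul_sum]
  rw [Finset.sum_comm]
  simp_rw [← mul_assoc, ← Finset.sum_mul]
  rw [Finset.sum_eq_single j]
  · simp [hdelta j hj]
  · intro l _ hl
    by_cases h : l ∈ S
    · simp [hdelta l h, hl.symm]
    · simp [hc l h]
  · simp

/-- Coordinates of lattice vectors with respect to independent columns of a unimodular matrix
are integral. -/
theorem IsUnimodular.exists_int_of_linearIndepOn {A : Matrix (Fin k) (Fin s) ℤ}
    (hA : IsUnimodular A) {S : Set (Fin s)} (hS : LinearIndepOn ℚ (rationalColumn A) S)
    {b : Fin k → ℤ} (hb : b ∈ columnLattice A) {c : Fin s → ℚ} (hc : ∀ j ∉ S, c j = 0)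
    (hAc : ∀ i, ∑ j, (A i j : ℚ) * c j = b i) : ∃ z : Fin s → ℤ, ∀ j, c j = z j := by
  classical
  obtain ⟨L, hL⟩ := exists_dual_of_linearIndepOn hS
  obtain ⟨N, hN⟩ : ∃ N : ℕ, ∀ j, 0 ≤ c j + N := by
    obtain ⟨N, hN⟩ := exists_nat_ge (∑ j, |c j|)
    refine ⟨N, fun j => ?_⟩
    have := Finset.single_le_sum (f := fun j => |c j|) (fun j _ => abs_nonneg _)
      (Finset.mem_univ j)
    have := neg_abs_le (c j)
    linarith
  -- Adding `N` to each coordinate in `S` makes `c` nonnegative, and changes neither integrality nor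
  -- membership of the right-hand side in the lattice.
  let e : Fin s → ℤ := fun j => if j ∈ S then N else 0
  have hb' : b + A.mulVec e ∈ columnLattice A := by
    refine add_mem hb ?_
    rw [Matrix.mulVec_eq_sum]
    refine sum_mem fun j _ => ?_
    rw [op_smul_eq_smul]
    exact Submodule.smul_mem _ _ (Submodule.subset_span ⟨j, rfl⟩)
  let v : Fin s → ℝ := fun j => (c j : ℝ) + e j
  have hv0 : ∀ j ∉ S, v j = 0 := fun j hj => by simp [v, e, hj, hc j hj]
  have hvP : v ∈ polyhedron A (b + A.mulVec e) := by
    refine ⟨?_, fun j => ?_⟩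
    · ext i
      have h1 : (∑ j, (A i j : ℝ) * c j) = b i := by exact_mod_cast hAc i
      simp [realMatrix, Matrix.mulVec, dotProduct, v, mul_add, Finset.sum_add_distrib, h1]
    · by_cases hj : j ∈ S
      · have : ((0 : ℚ) : ℝ) ≤ ((c j + N : ℚ) : ℝ) := by exact_mod_cast hN j
        simpa [v, e, hj] using this
      · simp [hv0 j hj]
  have huniq : ∀ x ∈ polyhedron A (b + A.mulVec e), (∀ j ∉ S, x j = 0) → x = v := by
    intro x hx hx0
    ext j
    by_cases hj : j ∈ S
    · rw [← sum_dual_mul_real hL x hx0 hj, ← sum_dual_mul_real hL v hv0 hj]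
      refine Finset.sum_congr rfl fun i _ => ?_
      congr 1
      exact (congrFun hx.1 i).trans (congrFun hvP.1 i).symm
    · rw [hx0 j hj, hv0 j hj]
  -- Coordinates where `v` vanishes vanish at both ends of any segment through `v` in the
  -- polyhedron; independence then leaves only `v`.
  have hext : v ∈ (polyhedron A (b + A.mulVec e)).extremePoints ℝ := by
    refine ⟨hvP, fun x hx y hy hxy => huniq x hx fun j hj => ?_⟩
    obtain ⟨p, q, hp, hq, -, hpq⟩ := hxy
    have h1 := congrFun hpq j
    rw [hv0 j hj] at h1
    simp only [Pi.add_apply, Pi.smul_apply, smul_eq_mul] at h1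
    have h2 : 0 ≤ x j := hx.2 j
    have h3 : 0 ≤ y j := hy.2 j
    have h4 : p * x j = 0 := by
      have := mul_nonneg hp.le h2
      have := mul_nonneg hq.le h3
      linarith
    exact (mul_eq_zero.1 h4).resolve_left hp.ne'
  obtain ⟨z, hz⟩ := hA _ hb' v hext
  refine ⟨z - e, fun j => ?_⟩
  have h1 : (c j : ℝ) + e j = z j := congrFun hz j
  have h2 : c j + e j = z j := by exact_mod_cast h1
  simp [← h2]

/-- In a unimodular matrix each dependent set of columns contains a column that is an integer
combination of the others. -/
theorem IsUnimodular.exists_mem_span_of_not_linearIndepOn {A : Matrix (Fin k) (Fin s) ℤ}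
    (hA : IsUnimodular A) {S : Set (Fin s)} (hS : ¬ LinearIndepOn ℚ (rationalColumn A) S) :
    ∃ e ∈ S, A.col e ∈ Submodule.span ℤ (A.col '' (S \ {e})) := by
  obtain ⟨B, hBS, -, hspan, hB⟩ :=
    exists_linearIndepOn_extension (linearIndepOn_empty ℚ (rationalColumn A)) (Set.empty_subset S)
  obtain ⟨e, heS, heB⟩ : ∃ e ∈ S, e ∉ B := by
    by_contra! h
    exact hS (hBS.antisymm h ▸ hB)
  refine ⟨e, heS, ?_⟩
  obtain ⟨l, hl, hle⟩ := (Finsupp.mem_span_image_iff_linearCombination ℚ).1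
    (hspan ⟨e, heS, rfl⟩)
  have hl0 : ∀ j ∉ B, l j = 0 := fun j hj => by
    by_contra h
    exact hj ((Finsupp.mem_supported _ _).1 hl (Finsupp.mem_support_iff.2 h))
  rw [Finsupp.linearCombination_apply, Finsupp.sum_fintype _ _ (by simp)] at hle
  have hAl : ∀ i, ∑ j, (A i j : ℚ) * l j = A.col e i := fun i => by
    have := congrFun hle i
    simpa [Finset.sum_apply, rationalColumn, mul_comm] using this
  obtain ⟨z, hz⟩ := hA.exists_int_of_linearIndepOn hB (Submodule.subset_span ⟨e, rfl⟩) hl0 hAl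
  have hcol : A.col e = ∑ j, z j • A.col j := by
    ext i
    have := hAl i
    simp only [hz] at this
    rw [Finset.sum_apply]
    simp only [Pi.smul_apply, smul_eq_mul, mul_comm (z _)]
    exact_mod_cast this.symm
  rw [hcol]
  refine sum_mem fun j _ => ?_
  by_cases hj : j ∈ B
  · refine Submodule.smul_mem _ _ (Submodule.subset_span ⟨j, ⟨hBS hj, ?_⟩, rfl⟩)
    rintro rfl
    exact heB hj
  · have : z j = 0 := by exact_mod_cast (hz j).symm.trans (hl0 j hj)
    simp [this]

/-! ### Eventual behaviour of polynomials -/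

theorem eventually_eval_ne_zero {p : ℚ[X]} (hp : p ≠ 0) :
    ∀ᶠ n : ℕ in atTop, p.eval (n : ℚ) ≠ 0 :=
  tendsto_natCast_atTop_atTop.eventually (p.eventually_atTop_not_isRoot hp)

theorem eventually_eval_nonneg_or_neg (p : ℚ[X]) :
    (∀ᶠ n : ℕ in atTop, 0 ≤ p.eval (n : ℚ)) ∨ ∀ᶠ n : ℕ in atTop, p.eval (n : ℚ) < 0 := by
  rcases le_or_gt p.degree 0 with hdeg | hdeg
  · rw [eq_C_of_degree_le_zero hdeg]
    rcases le_or_gt 0 (p.coeff 0) with h | h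
    · exact Or.inl (by simp [h])
    · exact Or.inr (by simp [h])
  · rcases le_total 0 p.leadingCoeff with h | h
    · exact Or.inl (((p.tendsto_atTop_of_leadingCoeff_nonneg hdeg h).comp
        tendsto_natCast_atTop_atTop).eventually_ge_atTop 0)
    · exact Or.inr (((p.tendsto_atBot_of_leadingCoeff_nonpos hdeg h).comp
        tendsto_natCast_atTop_atTop).eventually_lt_atBot 0)

/-- The value is `(t + 1) ⋯ (t + r) / r!`. Weight `0` is excluded: `multichoose 0` is the indicator
of `0`. -/
theorem exists_polynomial_multichoose (r : ℕ) :
    ∃ p : ℚ[X], ∀ t : ℕ, ((r + 1).multichoose t : ℚ) = p.eval (t : ℚ) := by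
  refine ⟨C (1 / (r.factorial : ℚ)) * (ascPochhammer ℚ r).comp (X + 1), fun t => ?_⟩
  have h : (r + 1).multichoose t = (t + r).choose r := by
    rw [Nat.multichoose_eq, show r + 1 + t - 1 = t + r by omega, Nat.choose_symm_add]
  have h1 : eval ((t : ℚ) + 1) (ascPochhammer ℚ r) = r.factorial * (t + r).choose r := by
    have := ascPochhammer_eval_cast ℚ r (t + 1)
    rw [ascPochhammer_nat_eq_ascFactorial, Nat.ascFactorial_eq_factorial_mul_choose] at this
    exact_mod_cast this.symm
  have h2 : (r.factorial : ℚ) ≠ 0 := by exact_mod_cast r.factorial_ne_zero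
  simp only [eval_mul, eval_C, eval_comp, eval_add, eval_X, eval_one, h1, h]
  field_simp

/-! ### Weighted counts -/

theorem weightedCount_eventuallyPolynomial_of_linearIndepOn {A : Matrix (Fin k) (Fin s) ℤ}
    (hA : IsUnimodular A) (w : Fin s → ℕ)
    (hw : LinearIndepOn ℚ (rationalColumn A) (support w)) :
    EventuallyPolynomialOnPaths A (weightedCount A w) := by
  classical
  intro m b hb hl
  obtain ⟨L, hL⟩ := exists_dual_of_linearIndepOn hw
  let c : Fin s → ℚ[X] := fun j => if j ∈ support w then ∑ i, C (L j i) * m i else 0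
  have hc0 : ∀ j ∉ support w, c j = 0 := fun j hj => if_neg hj
  have hc : ∀ n : ℕ, ∀ x ∈ fiber A (b n), ∏ j, ((w j).multichoose (x j) : ℚ) ≠ 0 →
      ∀ j, (x j : ℚ) = (c j).eval (n : ℚ) := by
    intro n x hx hne j
    have hx0 : ∀ j ∉ support w, (x j : ℚ) = 0 := by
      intro j hj
      have h1 := Finset.prod_ne_zero_iff.1 hne j (Finset.mem_univ j)
      rw [notMem_support.1 hj] at h1
      rcases hxj : x j with _ | t
      · simp
      · simp [hxj] at h1
    by_cases hj : j ∈ support w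
    · rw [← hL (fun j => (x j : ℚ)) hx0 j hj]
      simp only [c, if_pos hj, eval_finsetSum, eval_mul, eval_C, ← hb]
      refine Finset.sum_congr rfl fun i _ => ?_
      congr 1
      exact_mod_cast congrFun hx i
    · simp [hx0 j hj, hc0 j hj]
  have hzero : ∀ n : ℕ, (¬ ∃ x ∈ fiber A (b n), ∀ j, (x j : ℚ) = (c j).eval (n : ℚ)) →
      weightedCount A w (b n) = 0 := by
    intro n hn
    refine finsum_mem_of_eqOn_zero fun x hx => ?_
    by_contra h
    exact hn ⟨x, hx, hc n x hx h⟩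
  -- The `c j` are the only possible coordinates. A nonzero residual polynomial has finitely many
  -- roots, so eventually nothing contributes.
  by_cases hres : ∃ i, m i - ∑ j, C (A i j : ℚ) * c j ≠ 0
  · obtain ⟨i, hi⟩ := hres
    refine ⟨0, (eventually_eval_ne_zero hi).mono fun n hn => ?_⟩
    rw [eval_zero]
    refine hzero n fun ⟨x, hx, hxc⟩ => hn ?_
    have h1 : (∑ j, (A i j : ℚ) * x j) = b n i := by exact_mod_cast congrFun hx i
    simp [eval_finsetSum, ← hxc, ← hb, h1]
  push Not at hres
  have hAc : ∀ (n : ℕ) i, ∑ j, (A i j : ℚ) * (c j).eval (n : ℚ) = b n i := by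
    intro n i
    rw [hb, sub_eq_zero.1 (hres i)]
    simp [eval_finsetSum]
  by_cases hneg : ∃ j, ∀ᶠ n : ℕ in atTop, (c j).eval (n : ℚ) < 0
  · obtain ⟨j, hj⟩ := hneg
    refine ⟨0, hj.mono fun n hn => ?_⟩
    rw [eval_zero]
    refine hzero n fun ⟨x, hx, hxc⟩ => ?_
    rw [← hxc j] at hn
    exact absurd hn (by simp)
  have hpos : ∀ᶠ n : ℕ in atTop, ∀ j, 0 ≤ (c j).eval (n : ℚ) :=
    eventually_all.2 fun j => (eventually_eval_nonneg_or_neg (c j)).resolve_right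
      fun h => hneg ⟨j, h⟩
  choose q hq using exists_polynomial_multichoose
  refine ⟨∏ j, if w j = 0 then 1 else (q (w j - 1)).comp (c j), hpos.mono fun n hn => ?_⟩
  obtain ⟨z, hz⟩ := hA.exists_int_of_linearIndepOn hw (hl n)
    (c := fun j => (c j).eval (n : ℚ)) (fun j hj => by simp [hc0 j hj]) (hAc n)
  have hz0 : ∀ j, 0 ≤ z j := fun j => by
    have := hn j
    rw [hz j] at this
    exact_mod_cast this
  lift z to Fin s → ℕ using hz0
  have hzfib : z ∈ fiber A (b n) := by
    ext i
    have := hAc n i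
    simp only [hz] at this
    exact_mod_cast this
  have hsing : weightedCount A w (b n) = ∏ j, ((w j).multichoose (z j) : ℚ) := by
    rw [weightedCount, ← finsum_mem_singleton (a := z)
      (f := fun x : Fin s → ℕ => ∏ j, ((w j).multichoose (x j) : ℚ))]
    refine finsum_mem_inter_support_eq _ _ _ ?_
    ext x
    simp only [Set.mem_inter_iff, mem_support, Set.mem_singleton_iff]
    refine and_congr_left fun hx => ⟨fun hxf => ?_, fun h => h ▸ hzfib⟩
    ext j
    have : (x j : ℚ) = ((z j : ℤ) : ℚ) := (hc n x hxf hx j).trans (hz j)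
    exact_mod_cast this
  rw [hsing, eval_prod]
  refine Finset.prod_congr rfl fun j _ => ?_
  by_cases hj : w j = 0
  · have h1 : ((z j : ℤ) : ℚ) = 0 := by
      rw [← hz j, hc0 j (by simpa using hj), eval_zero]
    have h2 : z j = 0 := by exact_mod_cast h1
    simp [hj, h2]
  · rw [if_neg hj, eval_comp, hz j, Int.cast_natCast, ← hq, Nat.sub_add_cancel (by omega)]

theorem weightedCount_eventuallyPolynomial {A : Matrix (Fin k) (Fin s) ℤ}
    (hA : IsUnimodular A) (hfin : ∀ b, (fiber A b).Finite) (w : Fin s → ℕ) :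
    EventuallyPolynomialOnPaths A (weightedCount A w) := by
  induction hcard : (support w).ncard using Nat.strong_induction_on generalizing w with
  | _ N ih =>
  by_cases hw : LinearIndepOn ℚ (rationalColumn A) (support w)
  · exact weightedCount_eventuallyPolynomial_of_linearIndepOn hA w hw
  obtain ⟨e, he, hspan⟩ := hA.exists_mem_span_of_not_linearIndepOn hw
  -- Inner induction on the total weight off `e`, with the support fixed.
  suffices h : ∀ (M : ℕ) (v : Fin s → ℕ), support v = support w →
      ∑ j ∈ Finset.univ.erase e, v j = M → EventuallyPolynomialOnPaths A (weightedCount A v) from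
    h _ w rfl rfl
  intro M
  induction M using Nat.strong_induction_on with
  | _ M ihM =>
  intro v hv hM
  have hF : weightedCount A v = fun b => weightedCount A (v + Pi.single e 1) b -
      weightedCount A (v + Pi.single e 1) (b - A.col e) := by
    ext b
    rw [weightedCount_add_single hfin v e b]
    ring
  rw [hF]
  refine EventuallyPolynomialOnPaths.difference_of_mem_span ?_ ?_ hspan
  · rintro _ ⟨j, -, rfl⟩
    exact Submodule.subset_span ⟨j, rfl⟩
  rintro _ ⟨j, ⟨hjw, hje⟩, rfl⟩
  replace hje : j ≠ e := hje
  have hvj : v j ≠ 0 := by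
    rw [← hv] at hjw
    exact hjw
  let u : Fin s → ℕ := v + Pi.single e 1 - Pi.single j 1
  have hu : v + Pi.single e 1 = u + Pi.single j 1 := by
    refine (tsub_add_cancel_of_le fun i => ?_).symm
    by_cases h : i = j
    · subst h
      simpa [hje] using Nat.one_le_iff_ne_zero.2 hvj
    · simp [h]
  have hsub : support u ⊆ support w := by
    intro i hi
    by_cases hie : i = e
    · exact hie ▸ he
    · rw [← hv]
      intro h0
      exact hi (by simp [u, hie, h0])
  have hgood : EventuallyPolynomialOnPaths A (weightedCount A u) := by
    -- Passing from `v` to `u` lowers the weight off `e` by one; if this removes `j` from the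
    -- support, the outer induction applies.
    rcases hsub.eq_or_ssubset with heq | hss
    · refine ihM _ ?_ u heq rfl
      rw [← hM]
      refine Finset.sum_lt_sum (fun i hi => ?_) ⟨j, by simp [hje], ?_⟩
      · simp [u, Finset.ne_of_mem_erase hi]
      · simp only [u, Pi.sub_apply, Pi.add_apply, Pi.single_eq_same, Pi.single_eq_of_ne hje]
        omega
    · exact ih _ (hcard ▸ Set.ncard_lt_ncard hss) u rfl
  convert hgood using 2 with b
  rw [hu, weightedCount_add_single hfin u j b]
  ring

end VectorPartition

theorem theorem1p2 {k s : ℕ} (A : Matrix (Fin k) (Fin s) ℤ)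
    (hA : VectorPartition.IsUnimodular A)
    (hker : (LinearMap.ker (VectorPartition.realMatrix A).mulVecLin : Set (Fin s → ℝ)) ∩
      {x | 0 ≤ x} = {0})
    (m : Fin k → Polynomial ℚ) (hm : ∀ i, VectorPartition.IsIntegerValued (m i))
    (hlat : ∀ (n : ℕ) (b : Fin k → ℤ), (∀ i, (b i : ℚ) = (m i).eval (n : ℚ)) →
      b ∈ VectorPartition.columnLattice A) :
    (∀ n : ℕ, (VectorPartition.solutions A m n).Finite) ∧
      ∃ P : Polynomial ℚ, ∀ᶠ n : ℕ in Filter.atTop,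
        ((VectorPartition.solutions A m n).ncard : ℚ) = P.eval (n : ℚ) := by
  have hfin := VectorPartition.fiber_finite hker
  choose b hb using hm
  have hsol : ∀ n, VectorPartition.solutions A m n =
      VectorPartition.fiber A (fun i => b i n) := by
    intro n
    ext x
    simp only [VectorPartition.solutions, VectorPartition.fiber, Set.mem_ofPred_eq, funext_iff,
      Matrix.mulVec, dotProduct, hb]
    exact forall_congr' fun i => Int.cast_inj
  refine ⟨fun n => hsol n ▸ hfin _, ?_⟩
  -- With weights one, every solution counts once, since `multichoose 1 t = 1`.
  obtain ⟨P, hP⟩ := VectorPartition.weightedCount_eventuallyPolynomial hA hfin (fun _ => 1) m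
    (fun n i => b i n) (fun n i => (hb i n).symm)
    (fun n => hlat n _ fun i => (hb i n).symm)
  refine ⟨P, hP.mono fun n hn => ?_⟩
  rw [← hn, hsol, VectorPartition.weightedCount, finsum_mem_eq_finite_toFinset_sum _ (hfin _),
    Set.ncard_eq_toFinset_card _ (hfin _)]
  simp
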